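/- Let $S_1,S_2\subset\mathbb{R}^{N+1}$ be smooth non-degenerate (locally) convex hypersurfaces with affine normal fields $\xi_i$, conormal maps $\nu_i$ (so $\nu_i(\xi_i)=1$ and $\nu_i$ vanishes on tangent vectors of $S_i$) and Blaschke metrics $h_i$. Let $p_1\in S_1$, $p_2\in S_2$ be points whose tangent spaces are transversal, let $Z=T_{p_1}S_1\cap T_{p_2}S_2$, and for $i=1,2$ let $Y_i\in T_{p_i}S_i$ be a non-zero vector that is $h_i$-orthogonal to $Z$. Put $M=\frac{p_1+p_2}{2}$, $C=\frac{p_1-p_2}{2}$ and $$F(p_1,p_2,X)=\big(\nu_2(C)\,\nu_1+\nu_1(C)\,\nu_2\big)(X-M),\qquad X\in\mathbb{R}^{N+1},$$ and let $F_{p_i}(p_1,p_2,X)(W)$ denote the partial derivative of $F$ with respect to $p_i$ in the direction $W\in T_{p_i}S_i$. Let $$\lambda=\left(\frac{\nu_1(Y_2)^2}{\nu_2(Y_1)^2}\,\frac{h_1(Y_1,Y_1)}{h_2(Y_2,Y_2)}\right)^{1/3}$$ (real cube root). Then the system $$F(p_1,p_2,X)=0,\qquad F_{p_1}(p_1,p_2,X)(Y_1)=0,\qquad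 F_{p_2}(p_1,p_2,X)(Y_2)=0$$ has a solution $X\in\mathbb{R}^{N+1}$ if and only if $$\nu_1(C)=-\lambda\,\nu_2(C)\qquad\text{and}\qquad \lambda\,\nu_2(Y_1)^2\neq 4\,h_1(Y_1,Y_1)\,\nu_2(C).$$ In particular, whenever $\lambda\,\nu_2(Y_1)^2\neq 4\,h_1(Y_1,Y_1)\,\nu_2(C)$, the system has a solution if and only if $\nu_1(C)=-\lambda\,\nu_2(C)$. -/

import Mathlib

open scoped ContDiff Topology

noncomputable section

/-- The standard volume form `[X₁, …, X_N, V]` of `ℝ^{N+1}`. -/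
def bracket {N : ℕ} (X : Fin N → (Fin (N + 1) → ℝ)) (V : Fin (N + 1) → ℝ) : ℝ :=
  Matrix.det (Matrix.of (Fin.snoc (α := fun _ => Fin (N + 1) → ℝ) X V))

theorem bracket_add {N : ℕ} (X : Fin N → (Fin (N + 1) → ℝ)) (V W : Fin (N + 1) → ℝ) :
    bracket X (V + W) = bracket X V + bracket X W :=
  MultilinearMap.snoc_add
    (Matrix.detRowAlternating (R := ℝ) (n := Fin (N + 1))).toMultilinearMap X V W

theorem bracket_smul {N : ℕ} (X : Fin N → (Fin (N + 1) → ℝ)) (c : ℝ) (V : Fin (N + 1) → ℝ) :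
    bracket X (c • V) = c * bracket X V :=
  MultilinearMap.snoc_smul
    (Matrix.detRowAlternating (R := ℝ) (n := Fin (N + 1))).toMultilinearMap X c V

/-- A smooth hypersurface in `ℝ^{N+1}`, given by a regular parametrization `param` on an open
set `domain ⊆ ℝ^N`.  The tangent space of the hypersurface at the point `param u` is identified
with `ℝ^N` through the (injective) derivative of `param` at `u`. -/
structure HypersurfacePatch (N : ℕ) where
  domain : Set (Fin N → ℝ)
  param : (Fin N → ℝ) → (Fin (N + 1) → ℝ)
  isOpen_domain : IsOpen domain
  contDiffOn_param : ContDiffOn ℝ ∞ param domain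
  injective_fderiv : ∀ u ∈ domain, Function.Injective (fderiv ℝ param u)

namespace HypersurfacePatch

variable {N : ℕ}

/-- The vector of `ℝ^{N+1}` tangent to the hypersurface at `S.param u` with coordinates `y`. -/
def push (S : HypersurfacePatch N) (u y : Fin N → ℝ) : Fin (N + 1) → ℝ :=
  fderiv ℝ S.param u y

/-- The tangent space at `S.param u`, as a linear subspace of `ℝ^{N+1}`. -/
def tangentPlane (S : HypersurfacePatch N) (u : Fin N → ℝ) :
    Submodule ℝ (Fin (N + 1) → ℝ) :=
  LinearMap.range (fderiv ℝ S.param u : (Fin N → ℝ) →ₗ[ℝ] (Fin (N + 1) → ℝ))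

/-- `D_X Y` at `S.param u`, where `X` has coordinates `x` at `u` and `Y` is the tangent vector
field whose coordinates are the constant `y`. -/
def flatDeriv (S : HypersurfacePatch N) (u x y : Fin N → ℝ) : Fin (N + 1) → ℝ :=
  fderiv ℝ (fun w => S.push w y) u x

/-- The coordinate frame of the tangent space at `S.param u`. -/
def frame (S : HypersurfacePatch N) (u : Fin N → ℝ) : Fin N → (Fin (N + 1) → ℝ) :=
  fun i => S.push u (Pi.single i 1)

/-- `ξ` is a smooth vector field along the hypersurface, transversal to it. -/
def IsTransversalField (S : HypersurfacePatch N) (ξ : (Fin N → ℝ) → (Fin (N + 1) → ℝ)) : Prop :=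
  ContDiffOn ℝ ∞ ξ S.domain ∧ ∀ u ∈ S.domain, ξ u ∉ S.tangentPlane u

/-- The conormal map associated with the transversal field `ξ`: the linear functional on
`ℝ^{N+1}` with value `1` on `ξ u` and value `0` on the tangent space (see `conormal_normal` and
`conormal_tangent`), written as a quotient of determinants. -/
def conormal (S : HypersurfacePatch N) (ξ : (Fin N → ℝ) → (Fin (N + 1) → ℝ)) (u : Fin N → ℝ) :
    (Fin (N + 1) → ℝ) →ₗ[ℝ] ℝ where
  toFun V := bracket (S.frame u) V / bracket (S.frame u) (ξ u)
  map_add' V W := by rw [bracket_add, add_div]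
  map_smul' c V := by rw [bracket_smul, mul_div_assoc]; rfl

/-- The bilinear form `h` of the Gauss equation `D_X Y = ∇_X Y + h(X, Y) ξ`: the component of
`D_X Y` along `ξ` in the splitting of `ℝ^{N+1}` into the tangent space and the line of `ξ`. -/
def fundForm (S : HypersurfacePatch N) (ξ : (Fin N → ℝ) → (Fin (N + 1) → ℝ))
    (u x y : Fin N → ℝ) : ℝ :=
  S.conormal ξ u (S.flatDeriv u x y)

/-- The tangential component `∇_X Y` in the Gauss equation, as a vector of `ℝ^{N+1}`; `Y` has
constant coordinates `y`. -/
def inducedConn (S : HypersurfacePatch N) (ξ : (Fin N → ℝ) → (Fin (N + 1) → ℝ))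
    (u x y : Fin N → ℝ) : Fin (N + 1) → ℝ :=
  S.flatDeriv u x y - S.fundForm ξ u x y • ξ u

/-- The covariant derivative `(∇_X θ)(Y₁, …, Y_N)` at `S.param u` of the induced volume form
`θ(Y₁, …, Y_N) = [Y₁, …, Y_N, ξ]`; the `Y_i` are extended with constant coordinates, which does
not matter since the expression is tensorial. -/
def covDerivVolume (S : HypersurfacePatch N) (ξ : (Fin N → ℝ) → (Fin (N + 1) → ℝ))
    (u x : Fin N → ℝ) (y : Fin N → (Fin N → ℝ)) : ℝ :=
  fderiv ℝ (fun w => bracket (fun i => S.push w (y i)) (ξ w)) u x -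
    ∑ j : Fin N,
      bracket (Function.update (fun i => S.push u (y i)) j (S.inducedConn ξ u x (y j))) (ξ u)

/-- `ξ` is the affine normal vector field of the hypersurface (it is unique up to sign):
transversal, `∇θ = 0`, and `θ` is, up to orientation, the volume form `|det (h(Y_i, Y_j))|^{1/2}`
of `h`.  The form `S.fundForm ξ` is then the Blaschke metric. -/
structure IsAffineNormal (S : HypersurfacePatch N)
    (ξ : (Fin N → ℝ) → (Fin (N + 1) → ℝ)) : Prop where
  transversal : S.IsTransversalField ξ
  parallel_volume : ∀ u ∈ S.domain, ∀ (x : Fin N → ℝ) (y : Fin N → (Fin N → ℝ)),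
    S.covDerivVolume ξ u x y = 0
  volume_eq : ∀ u ∈ S.domain, ∀ y : Fin N → (Fin N → ℝ),
    |bracket (fun i => S.push u (y i)) (ξ u)| =
      Real.sqrt |Matrix.det (Matrix.of fun i j => S.fundForm ξ u (y i) (y j))|

/-- The hypersurface is non-degenerate: the symmetric form `(X, Y) ↦ D_X Y mod` (tangent space)
has trivial kernel at every point, i.e. `h` is non-degenerate for any transversal field. -/
def IsNondegenerate (S : HypersurfacePatch N) : Prop :=
  ∀ u ∈ S.domain, ∀ x : Fin N → ℝ, (∀ y, S.flatDeriv u x y ∈ S.tangentPlane u) → x = 0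

/-- The hypersurface is (locally) convex: near each of its points it lies on one side of the
tangent hyperplane at that point. -/
def IsLocallyConvex (S : HypersurfacePatch N) : Prop :=
  ∀ u ∈ S.domain, ∃ ℓ : (Fin (N + 1) → ℝ) →ₗ[ℝ] ℝ, ℓ ≠ 0 ∧
    (∀ X ∈ S.tangentPlane u, ℓ X = 0) ∧
    ∀ᶠ w in 𝓝 u, 0 ≤ ℓ (S.param w - S.param u)

theorem push_eq_sum (S : HypersurfacePatch N) (u y : Fin N → ℝ) :
    S.push u y = ∑ i, y i • S.frame u i := by
  conv_lhs => rw [← Finset.univ_sum_single y]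
  simp only [push, frame, map_sum]
  refine Finset.sum_congr rfl fun i _ => ?_
  rw [← map_smul]
  congr 1
  rw [← Pi.single_smul]
  simp

theorem conormal_tangent (S : HypersurfacePatch N) (ξ : (Fin N → ℝ) → (Fin (N + 1) → ℝ))
    (u : Fin N → ℝ) {X : Fin (N + 1) → ℝ} (hX : X ∈ S.tangentPlane u) :
    S.conormal ξ u X = 0 := by
  obtain ⟨y, rfl⟩ := hX
  change S.conormal ξ u (S.push u y) = 0
  rw [push_eq_sum, map_sum]
  refine Finset.sum_eq_zero fun i _ => ?_
  rw [map_smul]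
  have h0 : bracket (S.frame u) (S.frame u i) = 0 := by
    refine Matrix.det_zero_of_row_eq (i := Fin.castSucc i) (j := Fin.last N)
      (Fin.castSucc_lt_last i).ne ?_
    exact (Fin.snoc_castSucc (α := fun _ => Fin (N + 1) → ℝ) _ _ i).trans
      (Fin.snoc_last (α := fun _ => Fin (N + 1) → ℝ) _ _).symm
  simp [conormal, h0]

theorem conormal_normal (S : HypersurfacePatch N) {ξ : (Fin N → ℝ) → (Fin (N + 1) → ℝ)}
    (hξ : S.IsTransversalField ξ) {u : Fin N → ℝ} (hu : u ∈ S.domain) :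
    S.conormal ξ u (ξ u) = 1 := by
  have hframe : LinearIndependent ℝ (S.frame u) := by
    rw [Fintype.linearIndependent_iff]
    intro g hg i
    rw [← push_eq_sum] at hg
    have : g = 0 := S.injective_fderiv u hu (by rw [map_zero]; exact hg)
    simp [this]
  have hspan : ξ u ∉ Submodule.span ℝ (Set.range (S.frame u)) := by
    intro h
    refine hξ.2 u hu (Submodule.span_le.2 ?_ h)
    rintro _ ⟨i, rfl⟩
    exact ⟨Pi.single i 1, rfl⟩
  have hli : LinearIndependent ℝ
      (Fin.snoc (α := fun _ => Fin (N + 1) → ℝ) (S.frame u) (ξ u)) :=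
    hframe.finSnoc hspan
  have hdet : bracket (S.frame u) (ξ u) ≠ 0 := by
    have h1 := Matrix.linearIndependent_rows_iff_isUnit.1
      (show LinearIndependent ℝ (Matrix.of
        (Fin.snoc (α := fun _ => Fin (N + 1) → ℝ) (S.frame u) (ξ u))).row from hli)
    exact ((Matrix.isUnit_iff_isUnit_det _).1 h1).ne_zero
  exact div_self hdet

end HypersurfacePatch

/-- The real cube root (of a real number of either sign). -/
def realCbrt (x : ℝ) : ℝ := (SignType.sign x : ℝ) * |x| ^ (1 / 3 : ℝ)

/-- The mid-point of two points. -/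
def midPt {N : ℕ} (p₁ p₂ : Fin (N + 1) → ℝ) : Fin (N + 1) → ℝ := (1 / 2 : ℝ) • (p₁ + p₂)

/-- The mid-chord of two points. -/
def midChord {N : ℕ} (p₁ p₂ : Fin (N + 1) → ℝ) : Fin (N + 1) → ℝ := (1 / 2 : ℝ) • (p₁ - p₂)

/-- The function `F(p₁, p₂, X) = (ν₂(C) ν₁ + ν₁(C) ν₂)(X - M)`, at `p_i = S_i.param u_i`; its
zero set in `X` is the mid-hyperplane of `(p₁, p₂)`. -/
def midF {N : ℕ} (S₁ S₂ : HypersurfacePatch N) (ξ₁ ξ₂ : (Fin N → ℝ) → (Fin (N + 1) → ℝ))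
    (u₁ u₂ : Fin N → ℝ) (X : Fin (N + 1) → ℝ) : ℝ :=
  (S₂.conormal ξ₂ u₂ (midChord (S₁.param u₁) (S₂.param u₂)) • S₁.conormal ξ₁ u₁ +
    S₁.conormal ξ₁ u₁ (midChord (S₁.param u₁) (S₂.param u₂)) • S₂.conormal ξ₂ u₂)
    (X - midPt (S₁.param u₁) (S₂.param u₂))

/-- The number `λ = (ν₁(Y₂)² h₁(Y₁, Y₁) / (ν₂(Y₁)² h₂(Y₂, Y₂)))^{1/3}`, where `Y_i` is the
tangent vector of `S_i` at `S_i.param u_i` with coordinates `y_i`. -/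
def midLambda {N : ℕ} (S₁ S₂ : HypersurfacePatch N)
    (ξ₁ ξ₂ : (Fin N → ℝ) → (Fin (N + 1) → ℝ)) (u₁ u₂ y₁ y₂ : Fin N → ℝ) : ℝ :=
  realCbrt (((S₁.conormal ξ₁ u₁ (S₂.push u₂ y₂)) ^ 2 / (S₂.conormal ξ₂ u₂ (S₁.push u₁ y₁)) ^ 2) *
    (S₁.fundForm ξ₁ u₁ y₁ y₁ / S₂.fundForm ξ₂ u₂ y₂ y₂))

end

/-! Write A = ν₁(C), B = ν₂(C), x = ν₁(X - M), y = ν₂(X - M), so that F = Bx + Ay. Differentiating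
ν₁(W) = 0 along S₁ gives (D_{Y₁} ν₁)(W) = -h₁(Y₁, W) for tangent W (`fderiv_conormalCLM_push`).
Since Y₁ is h₁-orthogonal to Z, this derivative kills Z and hence equals α ν₁ - (h₁(Y₁,Y₁)/ν₂(Y₁))
ν₂ for some α. In F_{p₁}(Y₁) the coefficient α only multiplies F, so on F = 0 it disappears and the
equation involves only x, y, A, B (`fderiv_midF_left_eq_zero_iff`); the other derivative follows by
symmetry.

Every pair (x, y) comes from some X, so what remains is a scalar system (`exists_mid_system_iff`).
For B ≠ 0 its first equation gives x = At, y = -Bt; eliminating t from the other two gives A³ =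
(-λB)³, and then t(λ ν₂(Y₁)² - 4 h₁(Y₁,Y₁) B) = λ ν₂(Y₁)², which is solvable exactly when the
bracket is non-zero.

The divisions are legitimate because convexity and non-degeneracy make h_i definite
(`fundForm_self_ne_zero`), which in turn forces ν₂(Y₁) ≠ 0 and ν₁(Y₂) ≠ 0. -/

theorem differentiableAt_bracket {N : ℕ} {E : Type*} [NormedAddCommGroup E] [NormedSpace ℝ E]
    {X : Fin N → E → (Fin (N + 1) → ℝ)} {V : E → (Fin (N + 1) → ℝ)} {a : E}
    (hX : ∀ i, DifferentiableAt ℝ (X i) a) (hV : DifferentiableAt ℝ V a) :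
    DifferentiableAt ℝ (fun w => bracket (fun i => X i w) (V w)) a := by
  have hentry : ∀ i j, DifferentiableAt ℝ
      (fun w => Fin.snoc (α := fun _ => Fin (N + 1) → ℝ) (fun i => X i w) (V w) i j) a := by
    intro i j
    induction i using Fin.lastCases with
    | last => simpa using differentiableAt_pi.1 hV j
    | cast i => simpa using differentiableAt_pi.1 (hX i) j
  simp only [bracket, Matrix.det_apply, Matrix.of_apply]
  refine DifferentiableAt.fun_sum fun σ _ => DifferentiableAt.fun_const_smul ?_ _
  exact (HasFDerivAt.finsetProd fun i _ => (hentry (σ i) i).hasFDerivAt).differentiableAt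

theorem realCbrt_pow_three (x : ℝ) : realCbrt x ^ 3 = x := by
  have h : (|x| ^ (1 / 3 : ℝ)) ^ 3 = |x| := by
    rw [← Real.rpow_natCast, ← Real.rpow_mul (abs_nonneg x)]
    norm_num
  have hs : ((SignType.sign x : ℝ)) ^ 3 = SignType.sign x := by
    cases SignType.sign x <;> norm_num
  rw [realCbrt, mul_pow, h, hs, sign_mul_abs]

/-- A function of one real variable with a local minimum at a critical point has non-negative
second derivative there. -/
theorem deriv_deriv_nonneg_of_isLocalMin {f : ℝ → ℝ} {a : ℝ} (hmin : IsLocalMin f a)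
    (hc : ContinuousAt f a) : 0 ≤ deriv (deriv f) a := by
  by_contra! hneg
  -- A negative second derivative would make the point a local maximum as well, hence `f` locally
  -- constant.
  have hmax := isLocalMax_of_deriv_deriv_neg hneg hmin.deriv_eq_zero hc
  have hconst : f =ᶠ[𝓝 a] fun _ => f a := by
    filter_upwards [hmin, hmax] with x h₁ h₂ using le_antisymm h₂ h₁
  have h0 : deriv (deriv f) a = 0 := by
    rw [hconst.deriv.deriv_eq]
    simp
  exact hneg.ne h0

/-! ### Conormals, definiteness of h, and the derivative of the conormal. -/

namespace HypersurfacePatch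

variable {N : ℕ} {S : HypersurfacePatch N} {ξ : (Fin N → ℝ) → (Fin (N + 1) → ℝ)}
  {u : Fin N → ℝ}

theorem push_mem_tangentPlane (S : HypersurfacePatch N) (u y : Fin N → ℝ) :
    S.push u y ∈ S.tangentPlane u := ⟨y, rfl⟩

theorem contDiffAt_param (hu : u ∈ S.domain) : ContDiffAt ℝ ∞ S.param u :=
  S.contDiffOn_param.contDiffAt (S.isOpen_domain.mem_nhds hu)

theorem differentiableAt_param (hu : u ∈ S.domain) : DifferentiableAt ℝ S.param u :=
  (contDiffAt_param hu).differentiableAt (by simp)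

theorem differentiableAt_fderiv_param (hu : u ∈ S.domain) :
    DifferentiableAt ℝ (fderiv ℝ S.param) u :=
  ((contDiffAt_param hu).fderiv_right (m := 1) (by norm_cast)).differentiableAt (by simp)

theorem differentiableAt_push (hu : u ∈ S.domain) (y : Fin N → ℝ) :
    DifferentiableAt ℝ (fun w => S.push w y) u :=
  (differentiableAt_fderiv_param hu).clm_apply (differentiableAt_const y)

theorem flatDeriv_eq (hu : u ∈ S.domain) (x y : Fin N → ℝ) :
    S.flatDeriv u x y = fderiv ℝ (fderiv ℝ S.param) u x y := by
  have h := (differentiableAt_fderiv_param hu).hasFDerivAt.clm_apply (hasFDerivAt_const y u)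
  rw [flatDeriv, show (fun w => S.push w y) = fun w => fderiv ℝ S.param w y from rfl, h.fderiv]
  simp

theorem flatDeriv_comm (hu : u ∈ S.domain) (x y : Fin N → ℝ) :
    S.flatDeriv u x y = S.flatDeriv u y x := by
  rw [flatDeriv_eq hu, flatDeriv_eq hu]
  exact (contDiffAt_param hu).isSymmSndFDerivAt (by simp only [minSmoothness_of_isRCLikeNormedField]; exact WithTop.coe_le_coe.2 le_top) x y

theorem bracket_frame_ne_zero (hu : u ∈ S.domain) {V : Fin (N + 1) → ℝ}
    (hV : V ∉ S.tangentPlane u) : bracket (S.frame u) V ≠ 0 := by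
  have hframe : LinearIndependent ℝ (S.frame u) := by
    rw [Fintype.linearIndependent_iff]
    intro g hg i
    rw [← push_eq_sum] at hg
    have : g = 0 := S.injective_fderiv u hu (by rw [map_zero]; exact hg)
    simp [this]
  have hspan : V ∉ Submodule.span ℝ (Set.range (S.frame u)) := by
    intro h
    refine hV (Submodule.span_le.2 ?_ h)
    rintro _ ⟨i, rfl⟩
    exact ⟨Pi.single i 1, rfl⟩
  have hli : LinearIndependent ℝ
      (Fin.snoc (α := fun _ => Fin (N + 1) → ℝ) (S.frame u) V) := hframe.finSnoc hspan
  have h1 := Matrix.linearIndependent_rows_iff_isUnit.1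
    (show LinearIndependent ℝ (Matrix.of
      (Fin.snoc (α := fun _ => Fin (N + 1) → ℝ) (S.frame u) V)).row from hli)
  exact ((Matrix.isUnit_iff_isUnit_det _).1 h1).ne_zero

theorem conormal_eq_zero_iff (hξ : S.IsTransversalField ξ) (hu : u ∈ S.domain)
    {V : Fin (N + 1) → ℝ} : S.conormal ξ u V = 0 ↔ V ∈ S.tangentPlane u := by
  refine ⟨fun h => ?_, S.conormal_tangent ξ u⟩
  by_contra hV
  exact div_ne_zero (bracket_frame_ne_zero hu hV) (bracket_frame_ne_zero hu (hξ.2 u hu)) h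

@[simp]
theorem conormal_push (S : HypersurfacePatch N) (ξ : (Fin N → ℝ) → (Fin (N + 1) → ℝ))
    (u y : Fin N → ℝ) : S.conormal ξ u (S.push u y) = 0 :=
  S.conormal_tangent ξ u (S.push_mem_tangentPlane u y)

theorem apply_eq_conormal_mul (hξ : S.IsTransversalField ξ) (hu : u ∈ S.domain)
    {ℓ : (Fin (N + 1) → ℝ) →ₗ[ℝ] ℝ} (hℓ : ∀ X ∈ S.tangentPlane u, ℓ X = 0)
    (V : Fin (N + 1) → ℝ) : ℓ V = S.conormal ξ u V * ℓ (ξ u) := by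
  have h : V - S.conormal ξ u V • ξ u ∈ S.tangentPlane u := by
    rw [← conormal_eq_zero_iff hξ hu, map_sub, map_smul, conormal_normal S hξ hu]
    simp
  have := hℓ _ h
  rw [map_sub, map_smul, smul_eq_mul] at this
  linarith

/-- Along the coordinate line `u + t • y` the height `ℓ` has a minimum at `t = 0`, and its second
derivative there is the quantity in question. -/
theorem flatDeriv_nonneg_of_supporting (hu : u ∈ S.domain) {ℓ : (Fin (N + 1) → ℝ) →ₗ[ℝ] ℝ}
    (hℓ : ∀ᶠ w in 𝓝 u, 0 ≤ ℓ (S.param w - S.param u)) (y : Fin N → ℝ) :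
    0 ≤ ℓ (S.flatDeriv u y y) := by
  set L : (Fin (N + 1) → ℝ) →L[ℝ] ℝ := LinearMap.toContinuousLinearMap ℓ
  set c : ℝ → (Fin N → ℝ) := fun t => u + t • y
  have hc0 : c 0 = u := by simp [c]
  have hcd : ∀ t, HasDerivAt c y t := fun t => by
    simpa only [one_smul] using ((hasDerivAt_id' t).smul_const y).const_add u
  have hc : Filter.Tendsto c (𝓝 0) (𝓝 u) := by
    simpa [hc0] using (hcd 0).continuousAt.tendsto
  have hd : ∀ t, c t ∈ S.domain →
      HasDerivAt (fun t => L (S.param (c t))) (L (S.push (c t) y)) t := fun t ht =>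
    L.hasFDerivAt.comp_hasDerivAt t
      ((differentiableAt_param ht).hasFDerivAt.comp_hasDerivAt t (hcd t))
  have hmin : IsLocalMin (fun t => L (S.param (c t))) 0 := by
    filter_upwards [hc.eventually hℓ] with t ht
    rw [map_sub] at ht
    simpa [L, hc0] using ht
  have h1 : deriv (fun t => L (S.param (c t))) =ᶠ[𝓝 0] fun t => L (S.push (c t) y) := by
    filter_upwards [hc.eventually (S.isOpen_domain.mem_nhds hu)] with t ht using (hd t ht).deriv
  have h2 : HasDerivAt (fun t => L (S.push (c t) y)) (L (S.flatDeriv u y y)) 0 := by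
    refine L.hasFDerivAt.comp_hasDerivAt 0 ?_
    have hp := (differentiableAt_push hu y).hasFDerivAt
    rw [← hc0] at hp
    simpa [flatDeriv, hc0, Function.comp_def] using hp.comp_hasDerivAt 0 (hcd 0)
  have h := deriv_deriv_nonneg_of_isLocalMin hmin (hd 0 (by rwa [hc0])).continuousAt
  rwa [h1.deriv_eq, h2.deriv] at h

/-- The form `h` of a non-degenerate locally convex hypersurface is definite. -/
theorem fundForm_self_ne_zero (hnd : S.IsNondegenerate) (hconv : S.IsLocallyConvex)
    (hξ : S.IsTransversalField ξ) (hu : u ∈ S.domain) {y : Fin N → ℝ} (hy : y ≠ 0) :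
    S.fundForm ξ u y y ≠ 0 := by
  intro h0
  obtain ⟨ℓ, hℓ0, hℓT, hℓ⟩ := hconv u hu
  have hfac := apply_eq_conormal_mul hξ hu hℓT
  have hξ0 : ℓ (ξ u) ≠ 0 := fun h => hℓ0 (LinearMap.ext fun V => by simp [hfac V, h])
  have hyy : ℓ (S.flatDeriv u y y) = 0 := by
    rw [hfac, show S.conormal ξ u (S.flatDeriv u y y) = 0 from h0, zero_mul]
  refine hy (hnd u hu y fun z => ?_)
  rw [← conormal_eq_zero_iff hξ hu]
  by_contra hz
  have hb : ℓ (S.flatDeriv u y z) ≠ 0 := by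
    rw [hfac]
    exact mul_ne_zero hz hξ0
  -- A null vector of a semidefinite form lies in its kernel: evaluated at `z + t • y` the form has
  -- no `t ^ 2` term, and an affine function of `t` bounded below has slope zero.
  have hquad : ∀ t : ℝ, 0 ≤ ℓ (S.flatDeriv u z z) + 2 * t * ℓ (S.flatDeriv u y z) := by
    intro t
    have h := flatDeriv_nonneg_of_supporting hu hℓ (z + t • y)
    have hsymm := flatDeriv_comm hu y z
    rw [flatDeriv_eq hu] at h hyy hsymm ⊢
    rw [flatDeriv_eq hu] at hsymm ⊢
    simp only [map_add, map_smul, add_apply, smul_apply, ← hsymm, hyy, smul_eq_mul] at h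
    linarith
  -- At this `t` the affine function takes the value -1.
  have h := hquad (-(ℓ (S.flatDeriv u z z) + 1) / (2 * ℓ (S.flatDeriv u y z)))
  field_simp at h
  linarith

/-- The conormal as a continuous linear functional. -/
noncomputable def conormalCLM (S : HypersurfacePatch N) (ξ : (Fin N → ℝ) → (Fin (N + 1) → ℝ))
    (u : Fin N → ℝ) : (Fin (N + 1) → ℝ) →L[ℝ] ℝ :=
  LinearMap.toContinuousLinearMap (S.conormal ξ u)

@[simp]
theorem conormalCLM_apply (S : HypersurfacePatch N) (ξ : (Fin N → ℝ) → (Fin (N + 1) → ℝ))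
    (u : Fin N → ℝ) (V : Fin (N + 1) → ℝ) : S.conormalCLM ξ u V = S.conormal ξ u V := rfl

theorem differentiableAt_conormalCLM (hξ : S.IsTransversalField ξ) (hu : u ∈ S.domain) :
    DifferentiableAt ℝ (S.conormalCLM ξ) u := by
  -- In finite dimension it suffices to test on fixed vectors, where the conormal is a quotient of
  -- determinants.
  suffices h : ∀ V, DifferentiableAt ℝ (fun w => S.conormal ξ w V) u by
    have hsum : S.conormalCLM ξ = fun w => ∑ j, S.conormal ξ w (Pi.single j 1) •
        (ContinuousLinearMap.proj j : (Fin (N + 1) → ℝ) →L[ℝ] ℝ) := by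
      funext w
      ext V
      conv_lhs => rw [← Finset.univ_sum_single V]
      simp only [map_sum, conormalCLM_apply, sum_apply, smul_apply,
        ContinuousLinearMap.proj_apply, smul_eq_mul]
      refine Finset.sum_congr rfl fun j _ => ?_
      rw [mul_comm, ← smul_eq_mul, ← map_smul, ← Pi.single_smul, smul_eq_mul, mul_one]
    rw [hsum]
    exact DifferentiableAt.fun_sum fun j _ => (h _).smul_const _
  intro V
  have hframe : ∀ i, DifferentiableAt ℝ (fun w => S.frame w i) u := fun i =>
    differentiableAt_push hu _
  have hξd : DifferentiableAt ℝ ξ u :=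
    (hξ.1.contDiffAt (S.isOpen_domain.mem_nhds hu)).differentiableAt (by simp)
  have hden := differentiableAt_bracket hframe hξd
  have hnum := differentiableAt_bracket hframe (differentiableAt_const V)
  simp only [conormal, LinearMap.coe_mk, AddHom.coe_mk, div_eq_mul_inv]
  exact hnum.fun_mul (hden.fun_inv (bracket_frame_ne_zero hu (hξ.2 u hu)))

theorem fderiv_conormalCLM_push (hξ : S.IsTransversalField ξ) (hu : u ∈ S.domain)
    (x y : Fin N → ℝ) :
    fderiv ℝ (S.conormalCLM ξ) u x (S.push u y) = -S.fundForm ξ u x y := by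
  have h := (differentiableAt_conormalCLM hξ hu).hasFDerivAt.clm_apply
    (differentiableAt_push hu y).hasFDerivAt
  have h0 : (fun w => S.conormalCLM ξ w (S.push w y)) = fun _ => 0 := by
    funext w
    simp
  rw [h0] at h
  have := congrArg (fun L => L x) (h.unique (hasFDerivAt_const 0 u))
  simp only [add_apply, ContinuousLinearMap.comp_apply, ContinuousLinearMap.flip_apply,
    zero_apply, conormalCLM_apply] at this
  rw [fundForm, flatDeriv]
  linarith

/-- A tangent vector that is `h`-orthogonal to the intersection with another tangent plane, and not
`h`-null, is transversal to that plane. -/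
theorem conormal_push_ne_zero {S' : HypersurfacePatch N}
    {ξ' : (Fin N → ℝ) → (Fin (N + 1) → ℝ)} {u' : Fin N → ℝ}
    (hξ' : S'.IsTransversalField ξ') (hu' : u' ∈ S'.domain) {y : Fin N → ℝ}
    (hyy : S.fundForm ξ u y y ≠ 0)
    (horth : ∀ z, S.push u z ∈ S.tangentPlane u ⊓ S'.tangentPlane u' → S.fundForm ξ u y z = 0) :
    S'.conormal ξ' u' (S.push u y) ≠ 0 := fun h =>
  hyy (horth y ⟨S.push_mem_tangentPlane u y, (conormal_eq_zero_iff hξ' hu').1 h⟩)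

end HypersurfacePatch

open HypersurfacePatch

/-! ### Partial derivatives of F on its zero set. -/

section MidPlane

variable {N : ℕ} {S₁ S₂ : HypersurfacePatch N} {ξ₁ ξ₂ : (Fin N → ℝ) → (Fin (N + 1) → ℝ)}
  {u₁ u₂ : Fin N → ℝ}

/-- Gives the splitting of the ambient space into Z and the lines of Y₁ and Y₂: as ν₁(Y₁) = ν₂(Y₂) =
0, both conormals kill the difference. -/
theorem sub_combination_mem_inf (hξ₁ : S₁.IsTransversalField ξ₁) (hξ₂ : S₂.IsTransversalField ξ₂)
    (hu₁ : u₁ ∈ S₁.domain) (hu₂ : u₂ ∈ S₂.domain) {y₁ y₂ : Fin N → ℝ}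
    (h₂₁ : S₂.conormal ξ₂ u₂ (S₁.push u₁ y₁) ≠ 0) (h₁₂ : S₁.conormal ξ₁ u₁ (S₂.push u₂ y₂) ≠ 0)
    (V : Fin (N + 1) → ℝ) :
    V - ((S₁.conormal ξ₁ u₁ V / S₁.conormal ξ₁ u₁ (S₂.push u₂ y₂)) • S₂.push u₂ y₂ +
      (S₂.conormal ξ₂ u₂ V / S₂.conormal ξ₂ u₂ (S₁.push u₁ y₁)) • S₁.push u₁ y₁) ∈
      S₁.tangentPlane u₁ ⊓ S₂.tangentPlane u₂ := by
  rw [Submodule.mem_inf, ← conormal_eq_zero_iff hξ₁ hu₁, ← conormal_eq_zero_iff hξ₂ hu₂]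
  simp [h₁₂, h₂₁]

theorem sub_eq_sub_midPt_sub_midChord (X p q : Fin (N + 1) → ℝ) :
    X - p = X - midPt p q - midChord p q := by
  ext i
  simp [midPt, midChord]
  ring

/-- Product rule, with C and M both varying by half the tangent vector, which ν₁ kills; the
surviving first-order terms combine through X - p₁ = (X - M) - C. -/
theorem fderiv_midF_left (hξ₁ : S₁.IsTransversalField ξ₁) (hu₁ : u₁ ∈ S₁.domain)
    (X : Fin (N + 1) → ℝ) (y : Fin N → ℝ) :
    fderiv ℝ (fun w => midF S₁ S₂ ξ₁ ξ₂ w u₂ X) u₁ y =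
      S₂.conormal ξ₂ u₂ (S₁.push u₁ y) / 2 * S₁.conormal ξ₁ u₁ (X - S₁.param u₁) +
      S₂.conormal ξ₂ u₂ (midChord (S₁.param u₁) (S₂.param u₂)) *
        fderiv ℝ (S₁.conormalCLM ξ₁) u₁ y (X - midPt (S₁.param u₁) (S₂.param u₂)) +
      fderiv ℝ (S₁.conormalCLM ξ₁) u₁ y (midChord (S₁.param u₁) (S₂.param u₂)) *
        S₂.conormal ξ₂ u₂ (X - midPt (S₁.param u₁) (S₂.param u₂)) := by
  have hp := (differentiableAt_param hu₁).hasFDerivAt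
  have hC : HasFDerivAt (fun w => midChord (S₁.param w) (S₂.param u₂))
      ((1 / 2 : ℝ) • fderiv ℝ S₁.param u₁) u₁ := (hp.sub_const _).fun_const_smul _
  have hM : HasFDerivAt (fun w => X - midPt (S₁.param w) (S₂.param u₂))
      (-((1 / 2 : ℝ) • fderiv ℝ S₁.param u₁)) u₁ := ((hp.add_const _).fun_const_smul _).const_sub _
  have hn := (differentiableAt_conormalCLM hξ₁ hu₁).hasFDerivAt
  have hμ := (S₂.conormalCLM ξ₂ u₂).hasFDerivAt
    (x := midChord (S₁.param u₁) (S₂.param u₂))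
  have hμ' := (S₂.conormalCLM ξ₂ u₂).hasFDerivAt
    (x := X - midPt (S₁.param u₁) (S₂.param u₂))
  have h := ((hμ.comp u₁ hC).mul (hn.clm_apply hM)).add ((hn.clm_apply hC).mul (hμ'.comp u₁ hM))
  have hF : HasFDerivAt (fun w => midF S₁ S₂ ξ₁ ξ₂ w u₂ X) _ u₁ := h
  rw [hF.fderiv]
  have hpush : fderiv ℝ S₁.param u₁ y = S₁.push u₁ y := rfl
  rw [sub_eq_sub_midPt_sub_midChord X (S₁.param u₁) (S₂.param u₂), map_sub]
  simp [hpush]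
  ring

theorem midChord_comm (p q : Fin (N + 1) → ℝ) : midChord p q = -midChord q p := by
  simp [midChord, ← smul_neg]

theorem midPt_comm (p q : Fin (N + 1) → ℝ) : midPt p q = midPt q p := by
  simp [midPt, add_comm]

theorem midF_swap (S₁ S₂ : HypersurfacePatch N) (ξ₁ ξ₂ : (Fin N → ℝ) → (Fin (N + 1) → ℝ))
    (u₁ u₂ : Fin N → ℝ) (X : Fin (N + 1) → ℝ) :
    midF S₁ S₂ ξ₁ ξ₂ u₁ u₂ X = -midF S₂ S₁ ξ₂ ξ₁ u₂ u₁ X := by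
  simp only [midF, midChord_comm (S₁.param u₁), midPt_comm (S₁.param u₁), map_neg, LinearMap.add_apply, LinearMap.smul_apply, smul_eq_mul]
  ring

theorem fderiv_midF_left_eq_zero_iff
    (hξ₁ : S₁.IsTransversalField ξ₁) (hξ₂ : S₂.IsTransversalField ξ₂)
    (hu₁ : u₁ ∈ S₁.domain) (hu₂ : u₂ ∈ S₂.domain) {y₁ y₂ : Fin N → ℝ}
    (h₂₁ : S₂.conormal ξ₂ u₂ (S₁.push u₁ y₁) ≠ 0) (h₁₂ : S₁.conormal ξ₁ u₁ (S₂.push u₂ y₂) ≠ 0)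
    (horth : ∀ z : Fin N → ℝ, S₁.push u₁ z ∈ S₁.tangentPlane u₁ ⊓ S₂.tangentPlane u₂ →
      S₁.fundForm ξ₁ u₁ y₁ z = 0)
    {X : Fin (N + 1) → ℝ} (hX : midF S₁ S₂ ξ₁ ξ₂ u₁ u₂ X = 0) :
    fderiv ℝ (fun w => midF S₁ S₂ ξ₁ ξ₂ w u₂ X) u₁ y₁ = 0 ↔
      S₂.conormal ξ₂ u₂ (S₁.push u₁ y₁) ^ 2 *
        (S₁.conormal ξ₁ u₁ (X - midPt (S₁.param u₁) (S₂.param u₂)) -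
          S₁.conormal ξ₁ u₁ (midChord (S₁.param u₁) (S₂.param u₂))) =
      4 * S₁.fundForm ξ₁ u₁ y₁ y₁ * S₂.conormal ξ₂ u₂ (midChord (S₁.param u₁) (S₂.param u₂)) *
        S₂.conormal ξ₂ u₂ (X - midPt (S₁.param u₁) (S₂.param u₂)) := by
  set D := fderiv ℝ (S₁.conormalCLM ξ₁) u₁ y₁ with hD
  -- `D` vanishes on Z, so it is determined by its values on Y₁ and Y₂; the former is known and the
  -- latter is absorbed in `α`.
  obtain ⟨α, hα⟩ : ∃ α, ∀ V, D V = α * S₁.conormal ξ₁ u₁ V -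
      S₁.fundForm ξ₁ u₁ y₁ y₁ / S₂.conormal ξ₂ u₂ (S₁.push u₁ y₁) * S₂.conormal ξ₂ u₂ V := by
    refine ⟨D (S₂.push u₂ y₂) / S₁.conormal ξ₁ u₁ (S₂.push u₂ y₂), fun V => ?_⟩
    have hmem := sub_combination_mem_inf hξ₁ hξ₂ hu₁ hu₂ h₂₁ h₁₂ V
    obtain ⟨z, hz⟩ := hmem.1
    have hz' : S₁.push u₁ z = _ := hz
    rw [← hz'] at hmem
    have h0 : D (S₁.push u₁ z) = 0 := by
      rw [hD, fderiv_conormalCLM_push hξ₁ hu₁, horth z hmem, neg_zero]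
    have hyy : D (S₁.push u₁ y₁) = -S₁.fundForm ξ₁ u₁ y₁ y₁ :=
      fderiv_conormalCLM_push hξ₁ hu₁ _ _
    rw [hz', map_sub, map_add, map_smul, map_smul, hyy, smul_eq_mul, smul_eq_mul] at h0
    linear_combination h0
  rw [fderiv_midF_left hξ₁ hu₁ X y₁, ← hD, hα, hα, sub_eq_sub_midPt_sub_midChord X (S₁.param u₁) (S₂.param u₂), map_sub]
  simp only [midF, LinearMap.add_apply, LinearMap.smul_apply, smul_eq_mul] at hX
  generalize S₂.conormal ξ₂ u₂ (S₁.push u₁ y₁) = c at *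
  generalize S₁.conormal ξ₁ u₁ (X - midPt (S₁.param u₁) (S₂.param u₂)) = x at *
  generalize S₂.conormal ξ₂ u₂ (X - midPt (S₁.param u₁) (S₂.param u₂)) = y at *
  generalize S₁.conormal ξ₁ u₁ (midChord (S₁.param u₁) (S₂.param u₂)) = A at *
  generalize S₂.conormal ξ₂ u₂ (midChord (S₁.param u₁) (S₂.param u₂)) = B at *
  generalize S₁.fundForm ξ₁ u₁ y₁ y₁ = h at *
  -- The terms in `α` add up to `α * (B * x + A * y)`, which is zero by `hX`.
  have key : 2 * c * (c / 2 * (x - A) + B * (α * x - h / c * y) + (α * A - h / c * B) * y) =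
      c ^ 2 * (x - A) - 4 * h * B * y := by
    field_simp
    linear_combination 2 * c * α * hX
  rw [← sub_eq_zero (a := c ^ 2 * (x - A)), ← key]
  simp [h₂₁]

/-- Exchanging the surfaces fixes M and changes the signs of C and F, which accounts for the signs
here. -/
theorem fderiv_midF_right_eq_zero_iff
    (hξ₁ : S₁.IsTransversalField ξ₁) (hξ₂ : S₂.IsTransversalField ξ₂)
    (hu₁ : u₁ ∈ S₁.domain) (hu₂ : u₂ ∈ S₂.domain) {y₁ y₂ : Fin N → ℝ}
    (h₂₁ : S₂.conormal ξ₂ u₂ (S₁.push u₁ y₁) ≠ 0) (h₁₂ : S₁.conormal ξ₁ u₁ (S₂.push u₂ y₂) ≠ 0)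
    (horth : ∀ z : Fin N → ℝ, S₂.push u₂ z ∈ S₂.tangentPlane u₂ ⊓ S₁.tangentPlane u₁ →
      S₂.fundForm ξ₂ u₂ y₂ z = 0)
    {X : Fin (N + 1) → ℝ} (hX : midF S₁ S₂ ξ₁ ξ₂ u₁ u₂ X = 0) :
    fderiv ℝ (fun w => midF S₁ S₂ ξ₁ ξ₂ u₁ w X) u₂ y₂ = 0 ↔
      S₁.conormal ξ₁ u₁ (S₂.push u₂ y₂) ^ 2 *
        (S₂.conormal ξ₂ u₂ (X - midPt (S₁.param u₁) (S₂.param u₂)) +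
          S₂.conormal ξ₂ u₂ (midChord (S₁.param u₁) (S₂.param u₂))) =
      -(4 * S₂.fundForm ξ₂ u₂ y₂ y₂ *
        S₁.conormal ξ₁ u₁ (midChord (S₁.param u₁) (S₂.param u₂)) *
        S₁.conormal ξ₁ u₁ (X - midPt (S₁.param u₁) (S₂.param u₂))) := by
  have hX' : midF S₂ S₁ ξ₂ ξ₁ u₂ u₁ X = 0 := by
    rw [midF_swap, hX, neg_zero]
  simp only [midF_swap S₁ S₂ ξ₁ ξ₂ u₁ _ X]
  rw [fderiv_fun_neg, neg_apply, neg_eq_zero,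
    fderiv_midF_left_eq_zero_iff hξ₂ hξ₁ hu₂ hu₁ h₁₂ h₂₁ horth hX',
    midChord_comm, midPt_comm (S₂.param u₂)]
  simp only [map_neg, sub_neg_eq_add, mul_neg, neg_mul]

theorem exists_conormal_eq {y₁ y₂ : Fin N → ℝ}
    (h₂₁ : S₂.conormal ξ₂ u₂ (S₁.push u₁ y₁) ≠ 0) (h₁₂ : S₁.conormal ξ₁ u₁ (S₂.push u₂ y₂) ≠ 0)
    (x y : ℝ) : ∃ V, S₁.conormal ξ₁ u₁ V = x ∧ S₂.conormal ξ₂ u₂ V = y :=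
  ⟨(x / S₁.conormal ξ₁ u₁ (S₂.push u₂ y₂)) • S₂.push u₂ y₂ +
    (y / S₂.conormal ξ₂ u₂ (S₁.push u₁ y₁)) • S₁.push u₁ y₁, by simp [h₁₂], by simp [h₂₁]⟩

end MidPlane

/-! ### The scalar system. -/

theorem exists_mid_system_iff {a b h₁ h₂ l A B : ℝ} (ha : a ≠ 0) (hb : b ≠ 0) (hh₁ : h₁ ≠ 0)
    (hh₂ : h₂ ≠ 0) (hl : l ^ 3 * (a * h₂) = b * h₁) :
    (∃ x y, B * x + A * y = 0 ∧ a * (x - A) = 4 * h₁ * B * y ∧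
      b * (y + B) = -(4 * h₂ * A * x)) ↔ A = -l * B ∧ l * a ≠ 4 * h₁ * B := by
  have hl0 : l ≠ 0 := by
    rintro rfl
    exact mul_ne_zero hb hh₁ (by simpa using hl.symm)
  constructor
  · rintro ⟨x, y, h0, e₁, e₂⟩
    -- When `B = 0` the system forces `A = 0`, and the inequality reduces to `l * a ≠ 0`.
    by_cases hB : B = 0
    · subst hB
      have hx : x = A := by
        have : a * (x - A) = 0 := by rw [e₁]; ring
        linarith [(mul_eq_zero.1 this).resolve_left ha]
      have hA : A = 0 := by
        by_contra hA
        have hy : y = 0 := by simpa [hA] using h0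
        have h : 4 * h₂ * A * A = 0 := by
          rw [hy, hx] at e₂
          linarith
        simp [hh₂, hA] at h
      simp [hA, hl0, ha]
    · obtain ⟨t, rfl⟩ : ∃ t, y = -B * t := ⟨-y / B, by field_simp⟩
      obtain rfl : x = A * t := mul_left_cancel₀ hB (by linear_combination h0)
      have e₂' : b * B * (t - 1) = 4 * h₂ * A ^ 2 * t := by linear_combination -e₂
      have ht : t ≠ 0 := by
        rintro rfl
        exact mul_ne_zero hb hB (by linear_combination -e₂')
      have ht1 : t - 1 ≠ 0 := by
        intro h1
        have hA : A = 0 := by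
          by_contra hA
          have : 4 * h₂ * A ^ 2 * t = 0 := by rw [← e₂', h1, mul_zero]
          simp [hh₂, hA, ht] at this
        have : 4 * h₁ * B ^ 2 * t = 0 := by
          rw [hA] at e₁
          linear_combination e₁
        simp [hh₁, hB, ht] at this
      -- Cross-multiply `e₁` and `e₂'` and cancel `4 * t * (t - 1)`.
      have hcube : A ^ 3 = (-l * B) ^ 3 := by
        refine mul_left_cancel₀ (mul_ne_zero (mul_ne_zero ha hh₂)
          (mul_ne_zero (mul_ne_zero four_ne_zero ht) ht1)) ?_
        linear_combination (-a * A * (t - 1)) * e₂' + b * B * (t - 1) * e₁ +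
          B ^ 3 * (4 * t) * (t - 1) * hl
      have hA : A = -l * B := (Odd.strictMono_pow (R := ℝ) (n := 3) (by decide)).injective hcube
      refine ⟨hA, fun h => ?_⟩
      subst hA
      have : l * a * B = 0 := by linear_combination e₁ + B * t * h
      simp [hl0, ha, hB] at this
  · rintro ⟨rfl, hne⟩
    have hd : l * a - 4 * h₁ * B ≠ 0 := sub_ne_zero.2 hne
    -- With `A = -l * B`, `x = A * t` and `y = -B * t`, this `t` solves the second equation; `hl`
    -- makes the third equivalent to it up to a factor.
    set t := l * a / (l * a - 4 * h₁ * B) with ht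
    have htd : t * (l * a - 4 * h₁ * B) = l * a := div_mul_cancel₀ _ hd
    clear_value t
    refine ⟨-l * B * t, -B * t, by ring, by linear_combination -B * htd, ?_⟩
    refine mul_left_cancel₀ (mul_ne_zero ha hl0) ?_
    linear_combination (-b * B) * htd + (4 * B ^ 2 * t) * hl

theorem mainTheorem4 {N : ℕ} (S₁ S₂ : HypersurfacePatch N)
    (hnd₁ : S₁.IsNondegenerate) (hnd₂ : S₂.IsNondegenerate)
    (hconv₁ : S₁.IsLocallyConvex) (hconv₂ : S₂.IsLocallyConvex)
    (ξ₁ ξ₂ : (Fin N → ℝ) → (Fin (N + 1) → ℝ))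
    (hξ₁ : S₁.IsAffineNormal ξ₁) (hξ₂ : S₂.IsAffineNormal ξ₂)
    (u₁ u₂ : Fin N → ℝ) (hu₁ : u₁ ∈ S₁.domain) (hu₂ : u₂ ∈ S₂.domain)
    -- the tangent spaces at `p₁`, `p₂` are transversal
    (htrans : S₁.tangentPlane u₁ ⊔ S₂.tangentPlane u₂ = ⊤)
    -- `Y_i` is a nonzero tangent vector of `S_i`, `h_i`-orthogonal to `Z = T_{p₁}S₁ ∩ T_{p₂}S₂`
    (y₁ y₂ : Fin N → ℝ) (hy₁ : y₁ ≠ 0) (hy₂ : y₂ ≠ 0)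
    (horth₁ : ∀ z : Fin N → ℝ, S₁.push u₁ z ∈ S₁.tangentPlane u₁ ⊓ S₂.tangentPlane u₂ →
      S₁.fundForm ξ₁ u₁ y₁ z = 0)
    (horth₂ : ∀ z : Fin N → ℝ, S₂.push u₂ z ∈ S₁.tangentPlane u₁ ⊓ S₂.tangentPlane u₂ →
      S₂.fundForm ξ₂ u₂ y₂ z = 0) :
    (∃ X : Fin (N + 1) → ℝ,
        midF S₁ S₂ ξ₁ ξ₂ u₁ u₂ X = 0 ∧
        fderiv ℝ (fun w => midF S₁ S₂ ξ₁ ξ₂ w u₂ X) u₁ y₁ = 0 ∧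
        fderiv ℝ (fun w => midF S₁ S₂ ξ₁ ξ₂ u₁ w X) u₂ y₂ = 0) ↔
      S₁.conormal ξ₁ u₁ (midChord (S₁.param u₁) (S₂.param u₂)) =
          -midLambda S₁ S₂ ξ₁ ξ₂ u₁ u₂ y₁ y₂ *
            S₂.conormal ξ₂ u₂ (midChord (S₁.param u₁) (S₂.param u₂)) ∧
      midLambda S₁ S₂ ξ₁ ξ₂ u₁ u₂ y₁ y₂ * (S₂.conormal ξ₂ u₂ (S₁.push u₁ y₁)) ^ 2 ≠
        4 * S₁.fundForm ξ₁ u₁ y₁ y₁ *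
          S₂.conormal ξ₂ u₂ (midChord (S₁.param u₁) (S₂.param u₂)) := by
  have hT₁ := hξ₁.transversal
  have hT₂ := hξ₂.transversal
  have hh₁ := fundForm_self_ne_zero hnd₁ hconv₁ hT₁ hu₁ hy₁
  have hh₂ := fundForm_self_ne_zero hnd₂ hconv₂ hT₂ hu₂ hy₂
  have horth₂' : ∀ z : Fin N → ℝ, S₂.push u₂ z ∈ S₂.tangentPlane u₂ ⊓ S₁.tangentPlane u₁ →
      S₂.fundForm ξ₂ u₂ y₂ z = 0 := by simpa only [inf_comm] using horth₂
  have h₂₁ := conormal_push_ne_zero hT₂ hu₂ hh₁ horth₁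
  have h₁₂ := conormal_push_ne_zero hT₁ hu₁ hh₂ horth₂'
  have hl := realCbrt_pow_three (((S₁.conormal ξ₁ u₁ (S₂.push u₂ y₂)) ^ 2 /
    (S₂.conormal ξ₂ u₂ (S₁.push u₁ y₁)) ^ 2) *
    (S₁.fundForm ξ₁ u₁ y₁ y₁ / S₂.fundForm ξ₂ u₂ y₂ y₂))
  change midLambda S₁ S₂ ξ₁ ξ₂ u₁ u₂ y₁ y₂ ^ 3 = _ at hl
  have hl' : midLambda S₁ S₂ ξ₁ ξ₂ u₁ u₂ y₁ y₂ ^ 3 *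
      ((S₂.conormal ξ₂ u₂ (S₁.push u₁ y₁)) ^ 2 * S₂.fundForm ξ₂ u₂ y₂ y₂) =
      (S₁.conormal ξ₁ u₁ (S₂.push u₂ y₂)) ^ 2 * S₁.fundForm ξ₁ u₁ y₁ y₁ := by
    rw [hl]
    field_simp
  rw [← exists_mid_system_iff (pow_ne_zero 2 h₂₁) (pow_ne_zero 2 h₁₂) hh₁ hh₂ hl']
  have hsys := fun X => and_congr_right (fun hX : midF S₁ S₂ ξ₁ ξ₂ u₁ u₂ X = 0 => and_congr
    (fderiv_midF_left_eq_zero_iff hT₁ hT₂ hu₁ hu₂ h₂₁ h₁₂ horth₁ hX)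
    (fderiv_midF_right_eq_zero_iff hT₁ hT₂ hu₁ hu₂ h₂₁ h₁₂ horth₂' hX))
  simp only [hsys]
  simp only [midF, LinearMap.add_apply, LinearMap.smul_apply, smul_eq_mul]
  constructor
  · rintro ⟨X, h⟩
    exact ⟨_, _, h⟩
  · rintro ⟨x, y, h⟩
    -- A scalar solution is realized as the pair of conormal values of some V = X - M.
    obtain ⟨V, rfl, rfl⟩ := exists_conormal_eq h₂₁ h₁₂ x y
    refine ⟨V + midPt (S₁.param u₁) (S₂.param u₂), ?_⟩
    rw [add_sub_cancel_right]
    exact h
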